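/- Let $N\ge 1$. A ribbon graph (map) with $e\ge 1$ edges is a triple $(H,\alpha,\sigma)$ with $H=\{1,\dots,2e\}$ and permutations $\alpha,\sigma$ of $H$ such that $\alpha$ is a fixed-point-free involution and $\langle\alpha,\sigma\rangle$ acts transitively on $H$. An $N$-rooted map is a ribbon graph together with ordered elements $\hat h_1,\dots,\hat h_N\in H$ lying in $N$ distinct cycles of $\sigma$. An isomorphism $(H,\alpha,\sigma,\hat h)\to(H,\alpha',\sigma',\hat h')$ is a permutation $\psi$ of $H$ with $\alpha'\psi=\psi\alpha$, $\sigma'\psi=\psi\sigma$ and $\psi(\hat h_i)=\hat h_i'$ for all $i$. For $e\ge1$ let $m_N(e)$ be the number of isomorphism classes of $N$-rooted maps with $e$ edges; the one-point map without edges counts as a single $1$-rooted map, so $m_1(0)=1$ and $m_N(0)=0$ for $N\ge2$. Let $M_N(\lambda)=\sum_{e\ge0}m_N(e)\lambda^{2e}$, a formal power series, and for $j\ge 0$ let $$\mathcal Z_j=\sum_{k=0}^\infty\frac{(2k+j)!\,(2k-1)!!}{(2k)!}\,\lambda^{2k}\qquad\text{(with }(-1)!!=1).$$ Then, as formal power series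 in $\lambda$, $$M_N(\lambda)=\sum_{\substack{\alpha_1+2\alpha_2+\cdots+N\alpha_N=N\\ \alpha_1,\dots,\alpha_N\ge0}}\frac{N!}{\alpha_1!\cdots\alpha_N!}\;\frac{(-1)^{\alpha_1+\cdots+\alpha_N-1}(\alpha_1+\cdots+\alpha_N-1)!}{\mathcal Z_0^{\alpha_1+\cdots+\alpha_N}}\;\prod_{j=1}^N\Bigl(\frac{\mathcal Z_j}{(j!)^2}\Bigr)^{\alpha_j}.$$ Consequently, for every $e\ge0$, $m_N(e)$ is the coefficient of $\lambda^{2e}$ in the right-hand side, that is, $$m_N(e)=\frac1{(2e)!}\,\frac{d^{2e}}{d\lambda^{2e}}M_N(\lambda)\Big|_{\lambda=0},$$ with formal derivatives and evaluation at $\lambda=0$ meaning the constant term. -/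

import Mathlib

open scoped Nat PowerSeries

/-- A ribbon graph (a map) with `e` edges, on the set `Fin (2 * e)` of half-edges. -/
structure RibbonGraph (e : ℕ) where
  /-- the permutation whose cycles are the edges -/
  α : Equiv.Perm (Fin (2 * e))
  /-- the permutation whose cycles are the vertices -/
  σ : Equiv.Perm (Fin (2 * e))
  involutive : Function.Involutive α
  fixedPointFree : ∀ h, α h ≠ h
  transitive : MulAction.IsPretransitive (Subgroup.closure {α, σ}) (Fin (2 * e))

/-- An `N`-rooted ribbon graph with `e` edges: `N` ordered half-edges are chosen that lie on
pairwise different cycles of `σ` (a fixed point of `σ` is a cycle of length one). -/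
structure NRootedGraph (N e : ℕ) extends RibbonGraph e where
  root : Fin N → Fin (2 * e)
  root_distinct : ∀ i j, i ≠ j → ¬ σ.SameCycle (root i) (root j)

namespace NRootedGraph

/-- `N`-rooted isomorphism: a bijection of the half-edges that intertwines both permutations and
maps the `i`-th root to the `i`-th root. -/
def Iso {N e : ℕ} (Γ Γ' : NRootedGraph N e) : Prop :=
  ∃ ψ : Equiv.Perm (Fin (2 * e)),
    Γ'.α * ψ = ψ * Γ.α ∧ Γ'.σ * ψ = ψ * Γ.σ ∧ ∀ i, ψ (Γ.root i) = Γ'.root i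

theorem Iso.refl {N e : ℕ} (Γ : NRootedGraph N e) : Iso Γ Γ :=
  ⟨1, by simp, by simp, by simp⟩

theorem Iso.symm {N e : ℕ} {Γ Γ' : NRootedGraph N e} (h : Iso Γ Γ') : Iso Γ' Γ := by
  obtain ⟨ψ, ha, hs, hr⟩ := h
  refine ⟨ψ⁻¹, ?_, ?_, fun i => ?_⟩
  · rw [eq_inv_mul_iff_mul_eq, ← mul_assoc, ← ha, mul_assoc, mul_inv_cancel, mul_one]
  · rw [eq_inv_mul_iff_mul_eq, ← mul_assoc, ← hs, mul_assoc, mul_inv_cancel, mul_one]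
  · rw [← hr i]; exact ψ.symm_apply_apply _

theorem Iso.trans {N e : ℕ} {Γ₁ Γ₂ Γ₃ : NRootedGraph N e} (h : Iso Γ₁ Γ₂) (h' : Iso Γ₂ Γ₃) :
    Iso Γ₁ Γ₃ := by
  obtain ⟨ψ, ha, hs, hr⟩ := h
  obtain ⟨χ, ha', hs', hr'⟩ := h'
  refine ⟨χ * ψ, ?_, ?_, fun i => ?_⟩
  · rw [← mul_assoc, ha', mul_assoc, ha, mul_assoc]
  · rw [← mul_assoc, hs', mul_assoc, hs, mul_assoc]
  · rw [Equiv.Perm.mul_apply, hr, hr']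

instance setoid (N e : ℕ) : Setoid (NRootedGraph N e) where
  r := Iso
  iseqv := ⟨Iso.refl, Iso.symm, Iso.trans⟩

end NRootedGraph

/-- `m_N(e)`: the number of `N`-rooted maps with `e` edges, up to `N`-rooted isomorphism.
The only map without edges is the one-vertex map without half-edges; it counts as a one-rooted
map, and it has too few vertices to be `N`-rooted for `N ≥ 2`. -/
noncomputable def numNRootedMaps (N e : ℕ) : ℕ :=
  if e = 0 then (if N = 1 then 1 else 0)
  else Nat.card (Quotient (NRootedGraph.setoid N e))

/-- `M_N(λ) = ∑ₑ m_N(e) λ^(2e)`, a formal power series in `λ`. -/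
noncomputable def genNRootedMaps (N : ℕ) : ℚ⟦X⟧ :=
  PowerSeries.mk fun n => if Even n then (numNRootedMaps N (n / 2) : ℚ) else 0

/-- `𝒵_j(λ) = ∑ₖ (2k+j)! (2k-1)‼ / (2k)! λ^(2k)`, a formal power series in `λ`.
The double factorial `(-1)‼ = 1` at `k = 0` is `(2 * 0 - 1)‼ = 0‼ = 1` here. -/
noncomputable def genZ (j : ℕ) : ℚ⟦X⟧ :=
  PowerSeries.mk fun n =>
    if Even n then (((n + j)! : ℚ) * ((n - 1)‼ : ℚ)) / (n ! : ℚ) else 0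

/-- The tuples `(α₁, …, α_N)` of natural numbers with `α₁ + 2 α₂ + … + N α_N = N`;
`a j` stands for `α_(j+1)`. The bound `a j ≤ N` is automatic, see `mem_partitionTuples`. -/
def partitionTuples (N : ℕ) : Finset (Fin N → ℕ) :=
  (Fintype.piFinset fun _ : Fin N => Finset.range (N + 1)).filter
    fun a => ∑ j : Fin N, ((j : ℕ) + 1) * a j = N

theorem mem_partitionTuples {N : ℕ} (a : Fin N → ℕ) :
    a ∈ partitionTuples N ↔ ∑ j : Fin N, ((j : ℕ) + 1) * a j = N := by
  simp only [partitionTuples, Finset.mem_filter, Fintype.mem_piFinset, Finset.mem_range,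
    and_iff_right_iff_imp]
  intro h j
  have h1 : ((j : ℕ) + 1) * a j ≤ ∑ i : Fin N, ((i : ℕ) + 1) * a i :=
    Finset.single_le_sum (f := fun i : Fin N => ((i : ℕ) + 1) * a i)
      (fun _ _ => Nat.zero_le _) (Finset.mem_univ j)
  nlinarith [Nat.zero_le ((j : ℕ) * a j)]

/-- The sum over all `α₁ + 2 α₂ + … + N α_N = N` of
`N! / ∏ α_j! * (-1)^(s-1) (s-1)! / 𝒵₀^s * ∏ (𝒵_j / (j!)²)^(α_j)`, with `s = ∑ α_j`.
The inverse is that of formal power series (the constant term of `𝒵₀` is `1`),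
and `s ≥ 1` as soon as `N ≥ 1`. -/
noncomputable def closedForm (N : ℕ) : ℚ⟦X⟧ :=
  ∑ a ∈ partitionTuples N,
    (((N ! : ℚ) / ∏ j : Fin N, ((a j)! : ℚ)) *
        ((-1) ^ ((∑ j : Fin N, a j) - 1) * (((∑ j : Fin N, a j) - 1)! : ℚ))) •
      ((genZ 0 ^ (∑ j : Fin N, a j))⁻¹ *
        ∏ j : Fin N, (((((j : ℕ) + 1)! : ℚ) ^ 2)⁻¹ • genZ ((j : ℕ) + 1)) ^ a j)

/-! Replace each root by an extra point inserted into its cycle of `σ` just before the root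
half-edge. A map, connected or not, is then a pair `(α, τ)` on `n` half-edges and `N` root points:
`α` is an involution fixing exactly the root points, and no cycle of `τ` contains two of them.
Without connectedness the two permutations are independent, which gives `(n - 1)‼ * (n + N)! / N !`
pairs for even `n` (`pairNum_mul_factorial`); hence `𝒵_N / N!` is their exponential generating
function in `n`. Rooted connected maps have no nontrivial automorphism, so the connected pairs on `2
* e` half-edges number `(2 * e)! * m_N(e)` (`connNum_two_mul`). Splitting off the component of one
root (`pairNum_succ`, `genZ_succ`) says that `F(t) = ∑ 𝒵_N t^N / (N!)²` and `L(t) = ∑_{k ≥ 1} M_k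
t^k / k!` satisfy `F' = L' F`. Thus `L = log (F / 𝒵₀)`, where dividing by `𝒵₀` removes the
components without roots. Expanding the logarithm by the multinomial theorem
(`log_coeff_eq_sum_partitionTuples`) gives the closed form. -/

namespace PowerSeries

/-! ### Coefficients of the logarithm of a power series. -/

variable {R : Type*} [CommRing R]

/-- Only the part of `u` up to degree `N` matters, so `u` may be replaced by a polynomial `v`, to
which the multinomial theorem applies. -/
theorem coeff_pow_eq_sum_piAntidiag (c : ℕ → R) (u : R⟦X⟧) (hu : constantCoeff u = 0)
    (huc : ∀ n, coeff (n + 1) u = c (n + 1)) (N s : ℕ) :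
    coeff N (u ^ s) = ∑ a ∈ (Finset.piAntidiag (Finset.univ : Finset (Fin N)) s).filter
        (fun a => ∑ j : Fin N, ((j : ℕ) + 1) * a j = N),
      (Nat.multinomial Finset.univ a : R) * ∏ j : Fin N, c (j + 1) ^ a j := by
  set v : R⟦X⟧ := ∑ j : Fin N, C (c (j + 1)) * X ^ ((j : ℕ) + 1) with hv
  have hvc : ∀ n, coeff n v = if n = 0 then 0 else if n ≤ N then c n else 0 := by
    intro n
    rw [hv, map_sum, Fin.sum_univ_eq_sum_range (fun j => coeff n (C (c (j + 1)) * X ^ (j + 1)))]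
    simp only [coeff_C_mul, coeff_X_pow, mul_ite, mul_one, mul_zero]
    rcases n with _ | n
    · simp
    · simp
  have hd : X ^ (N + 1) ∣ u - v := by
    rw [X_pow_dvd_iff]
    rintro (_ | m) hm
    · rw [map_sub, hvc, coeff_zero_eq_constantCoeff_apply, hu, if_pos rfl, sub_zero]
    · rw [map_sub, hvc, huc, if_neg (by omega), if_pos (by omega), sub_self]
  have h1 : coeff N (u ^ s) = coeff N (v ^ s) := by
    have := X_pow_dvd_iff.1 (hd.trans (sub_dvd_pow_sub_pow u v s)) N (by omega)
    rwa [map_sub, sub_eq_zero] at this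
  rw [h1, hv, Finset.sum_pow_eq_sum_piAntidiag, map_sum, Finset.sum_filter]
  refine Finset.sum_congr rfl fun a _ => ?_
  have h2 : ∏ j : Fin N, (C (c (j + 1)) * X ^ ((j : ℕ) + 1)) ^ a j =
      C (∏ j : Fin N, c (j + 1) ^ a j) * X ^ (∑ j : Fin N, ((j : ℕ) + 1) * a j) := by
    simp only [mul_pow, Finset.prod_mul_distrib, ← pow_mul, Finset.prod_pow_eq_pow_sum,
      map_prod, map_pow]
  rw [h2, ← map_natCast (C (R := R)), coeff_C_mul, coeff_C_mul, coeff_X_pow]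
  simp only [eq_comm (a := N), mul_ite, mul_one, mul_zero]

variable [Algebra ℚ R]

/-- The truncated logarithm `∑_{s < N} (-1)^s u^(s+1) / (s+1)` of `1 + u`. -/
noncomputable def truncLog (N : ℕ) (u : R⟦X⟧) : R⟦X⟧ :=
  ∑ s ∈ Finset.range N, ((-1 : ℚ) ^ s / (s + 1)) • u ^ (s + 1)

/-- Termwise differentiation leaves a geometric sum in `-u`. The error `(-u) ^ N` is divisible by `X
^ N` once `u` has no constant term. -/
theorem one_add_mul_derivative_truncLog (N : ℕ) (u : R⟦X⟧) :
    (1 + u) * derivative R (truncLog N u) = (1 - (-u) ^ N) * derivative R u := by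
  have h : derivative R (truncLog N u) =
      (∑ s ∈ Finset.range N, (-u) ^ s) * derivative R u := by
    rw [truncLog, map_sum, Finset.sum_mul]
    refine Finset.sum_congr rfl fun s _ => ?_
    have h1 : derivative R (((-1 : ℚ) ^ s / (s + 1)) • u ^ (s + 1)) =
        ((-1 : ℚ) ^ s / (s + 1)) • derivative R (u ^ (s + 1)) := by
      exact map_rat_smul (derivative R) _ _
    rw [h1, derivative_pow, Nat.add_sub_cancel, mul_assoc, ← nsmul_eq_mul,
      ← Nat.cast_smul_eq_nsmul ℚ, smul_smul, Nat.cast_add_one, div_mul_cancel₀ _ (by positivity),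
      neg_pow u, mul_assoc]
    rcases neg_one_pow_eq_or ℚ s with h2 | h2 <;> rcases Nat.even_or_odd s with h3 | h3 <;>
      simp [h3.neg_one_pow]
  rw [h, ← mul_assoc, show (1 + u : R⟦X⟧) = 1 - -u by ring, mul_neg_geom_sum]

/-- Here `l` plays the role of `log (1 + u)`, known only through its derivative and so only up to
its constant term. The derivatives of `l` and `truncLog N u` agree modulo `X ^ N`, and `N` is
invertible. -/
theorem coeff_eq_coeff_truncLog {u l : R⟦X⟧} (hu : constantCoeff u = 0)
    (h : (1 + u) * derivative R l = derivative R u) {N : ℕ} (hN : 1 ≤ N) :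
    coeff N l = coeff N (truncLog N u) := by
  have hX : X ∣ u := X_dvd_iff.2 hu
  have h1 : (1 + u) * (derivative R l - derivative R (truncLog N u)) =
      (-u) ^ N * derivative R u := by
    rw [mul_sub, h, one_add_mul_derivative_truncLog]; ring
  have hunit : IsUnit (1 + u) := by
    rw [isUnit_iff_constantCoeff]; simp [hu]
  have h2 : X ^ N ∣ derivative R l - derivative R (truncLog N u) := by
    rw [← hunit.dvd_mul_left, h1]
    exact (pow_dvd_pow_of_dvd ((dvd_neg).2 hX) N).mul_right _
  have h3 := X_pow_dvd_iff.1 h2 (N - 1) (by omega)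
  rw [map_sub, coeff_derivative, coeff_derivative, Nat.sub_add_cancel hN, sub_eq_zero,
    Nat.cast_sub hN, Nat.cast_one, sub_add_cancel] at h3
  have hNu : IsUnit (N : R) := by
    have := (IsUnit.mk0 (N : ℚ) (by positivity)).map (algebraMap ℚ R)
    simpa using this
  exact hNu.mul_right_cancel h3

/-- The coefficients of the logarithm of a power series with constant coefficient one, in terms of
the logarithmic derivative. -/
theorem log_coeff_eq_sum_partitionTuples (c l : ℕ → R) (hc : c 0 = 1)
    (h : ∀ n : ℕ, ((n : R) + 1) * c (n + 1) =
      ∑ p ∈ Finset.HasAntidiagonal.antidiagonal n, ((p.1 : R) + 1) * l (p.1 + 1) * c p.2)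
    {N : ℕ} (hN : 1 ≤ N) :
    l N = ∑ a ∈ partitionTuples N,
      (((-1) ^ ((∑ j, a j) - 1) * (((∑ j, a j) - 1)! : ℚ)) / ∏ j, ((a j)! : ℚ)) •
        ∏ j : Fin N, c (j + 1) ^ a j := by
  set u : R⟦X⟧ := mk c - 1 with hu
  have hu0 : constantCoeff u = 0 := by
    rw [hu, map_sub, ← coeff_zero_eq_constantCoeff_apply, coeff_mk, hc]; simp
  have huc : ∀ n, coeff (n + 1) u = c (n + 1) := by
    intro n; rw [hu, map_sub, coeff_mk, coeff_one]; simp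
  have h1 : (1 + u) * derivative R (mk l) = derivative R u := by
    ext n
    rw [hu, add_sub_cancel, mul_comm, coeff_mul, map_sub, map_sub, coeff_derivative,
      coeff_derivative, coeff_mk, coeff_one, if_neg (by omega), zero_mul, sub_zero, mul_comm (c _), h]
    refine Finset.sum_congr rfl fun p _ => ?_
    rw [coeff_derivative, coeff_mk, coeff_mk, mul_comm (l _)]
  have h2 := coeff_eq_coeff_truncLog hu0 h1 hN
  rw [coeff_mk] at h2
  rw [h2, truncLog, map_sum]
  have hmaps : ∀ a ∈ partitionTuples N, (∑ j, a j) - 1 ∈ Finset.range N ∧ 1 ≤ ∑ j, a j := by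
    intro a ha
    rw [mem_partitionTuples] at ha
    have h3 : ∑ j, a j ≤ N := by
      calc ∑ j, a j ≤ ∑ j : Fin N, ((j : ℕ) + 1) * a j :=
            Finset.sum_le_sum fun j _ => Nat.le_mul_of_pos_left _ (by omega)
        _ = N := ha
    have h4 : ∑ j, a j ≠ 0 := by
      intro h0
      rw [Finset.sum_eq_zero_iff] at h0
      have : ∑ j : Fin N, ((j : ℕ) + 1) * a j = 0 :=
        Finset.sum_eq_zero fun j hj => by rw [h0 j hj, mul_zero]
      omega
    rw [Finset.mem_range]
    omega
  -- Tuples are grouped by `s = ∑ a j - 1`, matching the power `u ^ (s + 1)`; the truncated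
  -- subtraction is harmless because `1 ≤ ∑ a j`.
  rw [← Finset.sum_fiberwise_of_maps_to fun a ha => (hmaps a ha).1]
  refine Finset.sum_congr rfl fun s _ => ?_
  have hset : (partitionTuples N).filter (fun a => (∑ j, a j) - 1 = s) =
      (Finset.piAntidiag (Finset.univ : Finset (Fin N)) (s + 1)).filter
        (fun a => ∑ j : Fin N, ((j : ℕ) + 1) * a j = N) := by
    ext a
    simp only [Finset.mem_filter, Finset.mem_piAntidiag, Finset.mem_univ, implies_true, and_true]
    constructor
    · rintro ⟨ha, hs⟩
      have := (hmaps a ha).2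
      exact ⟨show ∑ j, a j = s + 1 by omega, (mem_partitionTuples a).1 ha⟩
    · rintro ⟨hs, ha⟩
      exact ⟨(mem_partitionTuples a).2 ha, Nat.sub_eq_of_eq_add hs⟩
  rw [hset, ← algebraMap_smul R, coeff_smul, algebraMap_smul,
    coeff_pow_eq_sum_piAntidiag c u hu0 huc,
    Finset.smul_sum]
  refine Finset.sum_congr rfl fun a ha => ?_
  simp only [Finset.mem_filter, Finset.mem_piAntidiag, Finset.mem_univ, implies_true,
    and_true] at ha
  rw [ha.1, Nat.add_sub_cancel, ← nsmul_eq_mul, ← Nat.cast_smul_eq_nsmul ℚ, smul_smul]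
  congr 1
  have h5 := Nat.multinomial_spec (Finset.univ : Finset (Fin N)) a
  rw [ha.1, Nat.factorial_succ] at h5
  have h6 : (∏ j, ((a j)! : ℚ)) * (Nat.multinomial Finset.univ a : ℚ) = (s + 1) * (s ! : ℚ) := by
    exact_mod_cast h5
  have h7 : (∏ j, ((a j)! : ℚ)) ≠ 0 := Finset.prod_ne_zero_iff.2 fun j _ => by positivity
  have h8 : (s + 1 : ℚ) ≠ 0 := by positivity
  field_simp
  linear_combination h6

end PowerSeries

/-! ### Orbits of a pair of permutations. -/

open Equiv

/-- Two points are linked by `f` and `g` if no set that is invariant under `f` and `g` separates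
them, that is, if they lie in the same orbit of the group generated by `f` and `g`. -/
def Linked {V : Type*} (f g : Perm V) (x y : V) : Prop :=
  ∀ T : Set V, (∀ z, f z ∈ T ↔ z ∈ T) → (∀ z, g z ∈ T ↔ z ∈ T) → (x ∈ T ↔ y ∈ T)

namespace Linked

variable {V W : Type*} {f g : Perm V} {f' g' : Perm W} {x y z : V}

theorem refl (f g : Perm V) (x : V) : Linked f g x x := fun _ _ _ => Iff.rfl

theorem symm (h : Linked f g x y) : Linked f g y x := fun T hf hg => (h T hf hg).symm

theorem trans (h : Linked f g x y) (h' : Linked f g y z) : Linked f g x z :=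
  fun T hf hg => (h T hf hg).trans (h' T hf hg)

theorem apply_left (f g : Perm V) (x : V) : Linked f g x (f x) := fun _ hf _ => (hf x).symm

theorem apply_right (f g : Perm V) (x : V) : Linked f g x (g x) := fun _ _ hg => (hg x).symm

/-- Invariant sets pull back along `m`. Since `m` need not commute with the permutations, it may
collapse points; this is how inserted or foreign points are forgotten below. -/
theorem map (m : V → W) (hf : ∀ z, Linked f' g' (m z) (m (f z)))
    (hg : ∀ z, Linked f' g' (m z) (m (g z))) (h : Linked f g x y) :
    Linked f' g' (m x) (m y) :=
  fun T hf' hg' => h (m ⁻¹' T) (fun z => (hf z T hf' hg').symm) (fun z => (hg z T hf' hg').symm)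

theorem permCongr_iff (e : V ≃ W) :
    Linked (e.permCongr f) (e.permCongr g) (e x) (e y) ↔ Linked f g x y := by
  constructor
  · intro h
    have := h.map (f' := f) (g' := g) e.symm (fun z => ?_) (fun z => ?_)
    · simpa using this
    · simpa [permCongr_apply] using apply_left f g (e.symm z)
    · simpa [permCongr_apply] using apply_right f g (e.symm z)
  · refine map e (fun z => ?_) (fun z => ?_)
    · simpa [permCongr_apply] using apply_left (e.permCongr f) (e.permCongr g) (e z)
    · simpa [permCongr_apply] using apply_right (e.permCongr f) (e.permCongr g) (e z)

theorem sumCongr_inl_iff : Linked (sumCongr f f') (sumCongr g g') (.inl x) (.inl y) ↔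
    Linked f g x y := by
  constructor
  · refine map (Sum.elim id fun _ => x) ?_ ?_
    · rintro (z | z)
      · exact apply_left f g z
      · exact refl f g x
    · rintro (z | z)
      · exact apply_right f g z
      · exact refl f g x
  · exact map Sum.inl (fun z => apply_left (sumCongr f f') (sumCongr g g') (.inl z))
      (fun z => apply_right (sumCongr f f') (sumCongr g g') (.inl z))

theorem sumCongr_inr_iff {x y : W} :
    Linked (sumCongr f f') (sumCongr g g') (.inr x) (.inr y) ↔ Linked f' g' x y := by
  constructor
  · refine map (Sum.elim (fun _ => x) id) ?_ ?_
    · rintro (z | z)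
      · exact refl f' g' x
      · exact apply_left f' g' z
    · rintro (z | z)
      · exact refl f' g' x
      · exact apply_right f' g' z
  · exact map Sum.inr (fun z => apply_left (sumCongr f f') (sumCongr g g') (.inr z))
      (fun z => apply_right (sumCongr f f') (sumCongr g g') (.inr z))

theorem not_sumCongr_inl_inr {x : V} {y : W} :
    ¬ Linked (sumCongr f f') (sumCongr g g') (.inl x) (.inr y) := by
  intro h
  have := h (Set.range Sum.inl) (by rintro (z | z) <;> simp) (by rintro (z | z) <;> simp)
  simp at this

/-- Cycles are the orbits for `f = 1`, so the transport lemmas for `Linked` apply to them too. -/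
theorem one_iff_sameCycle : Linked 1 g x y ↔ g.SameCycle x y := by
  constructor
  · intro h
    refine (h {z | g.SameCycle x z} (fun z => Iff.rfl) (fun z => ?_)).1 (Perm.SameCycle.refl g x)
    exact Perm.sameCycle_apply_right
  · rintro ⟨i, rfl⟩
    induction i with
    | zero => exact refl _ _ _
    | succ i ih =>
      refine ih.trans ?_
      rw [add_comm, zpow_one_add, Perm.mul_apply]
      exact apply_right _ _ _
    | pred i ih =>
      refine ih.trans (symm ?_)
      convert apply_right 1 g _ using 1
      rw [← Perm.mul_apply, ← zpow_one_add]
      congr 2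
      ring

theorem forall_iff_isPretransitive :
    (∀ x y, Linked f g x y) ↔ MulAction.IsPretransitive (Subgroup.closure {f, g}) V := by
  constructor
  · intro h
    refine ⟨fun x y => ?_⟩
    have hf : f ∈ Subgroup.closure {f, g} := Subgroup.subset_closure (by simp)
    have hg : g ∈ Subgroup.closure {f, g} := Subgroup.subset_closure (by simp)
    refine (h x y (MulAction.orbit (Subgroup.closure {f, g}) x) (fun z => ?_) (fun z => ?_)).1
      (MulAction.mem_orbit_self x)
    · rw [← MulAction.orbit_eq_iff, ← MulAction.orbit_eq_iff,
        ← MulAction.orbit_smul (⟨f, hf⟩ : Subgroup.closure {f, g}) z]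
      rfl
    · rw [← MulAction.orbit_eq_iff, ← MulAction.orbit_eq_iff,
        ← MulAction.orbit_smul (⟨g, hg⟩ : Subgroup.closure {f, g}) z]
      rfl
  · intro h x y T hfT hgT
    obtain ⟨⟨p, hp⟩, rfl⟩ := h.exists_smul_eq x y
    change x ∈ T ↔ p x ∈ T
    clear h
    induction hp using Subgroup.closure_induction generalizing x with
    | mem p hp =>
      rcases hp with rfl | rfl
      · exact (hfT x).symm
      · exact (hgT x).symm
    | one => rfl
    | mul p q _ _ hp hq => exact (hq x).trans (hp (q x))
    | inv p _ hp => simpa using (hp (p⁻¹ x)).symm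

end Linked

/-! ### Rooted pairs and the component of a root. -/

/-- An involution `α` whose fixed points are the elements of `R`, and a permutation `τ` whose
cycles contain at most one element of `R` each. Such pairs are the not necessarily connected
ribbon graphs with vertex roots: the elements of `R` mark the roots of the vertices. -/
structure IsRooted {V : Type*} (R : Set V) (α τ : Perm V) : Prop where
  involutive : ∀ x, α (α x) = x
  fixed_iff : ∀ x, α x = x ↔ x ∈ R
  eq_of_linked : ∀ x ∈ R, ∀ y ∈ R, Linked 1 τ x y → x = y

theorem isRooted_permCongr_iff {V W : Type*} (e : V ≃ W) {R : Set W} {α τ : Perm V} :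
    IsRooted R (e.permCongr α) (e.permCongr τ) ↔ IsRooted (e ⁻¹' R) α τ := by
  have h1 : e.permCongr (1 : Perm V) = 1 := by ext; simp [permCongr_apply]
  have h2 : ∀ x y, Linked 1 (e.permCongr τ) (e x) (e y) ↔ Linked 1 τ x y := fun x y => by
    rw [← h1, Linked.permCongr_iff]
  constructor
  · rintro ⟨ha, hb, hc⟩
    refine ⟨fun x => ?_, fun x => ?_, fun x hx y hy h => ?_⟩
    · simpa [permCongr_apply] using ha (e x)
    · simpa [permCongr_apply] using hb (e x)
    · exact e.injective (hc _ hx _ hy ((h2 x y).2 h))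
  · rintro ⟨ha, hb, hc⟩
    refine ⟨fun x => ?_, fun x => ?_, fun x hx y hy h => ?_⟩
    · simpa [permCongr_apply] using congrArg e (ha (e.symm x))
    · simpa [permCongr_apply, ← e.eq_symm_apply] using hb (e.symm x)
    · obtain ⟨x, rfl⟩ := e.surjective x
      obtain ⟨y, rfl⟩ := e.surjective y
      rw [hc x hx y hy ((h2 x y).1 h)]

theorem isRooted_sumCongr_iff {A B : Type*} {R : Set (A ⊕ B)} {α τ : Perm A} {α' τ' : Perm B} :
    IsRooted R (sumCongr α α') (sumCongr τ τ') ↔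
      IsRooted (Sum.inl ⁻¹' R) α τ ∧ IsRooted (Sum.inr ⁻¹' R) α' τ' := by
  have h1 : (1 : Perm (A ⊕ B)) = sumCongr (1 : Perm A) (1 : Perm B) := by ext (x | x) <;> rfl
  constructor
  · rintro ⟨ha, hb, hc⟩
    rw [h1] at hc
    exact ⟨⟨fun x => by simpa using ha (.inl x), fun x => by simpa using hb (.inl x),
      fun x hx y hy h => Sum.inl_injective (hc _ hx _ hy (Linked.sumCongr_inl_iff.2 h))⟩,
      ⟨fun x => by simpa using ha (.inr x), fun x => by simpa using hb (.inr x),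
      fun x hx y hy h => Sum.inr_injective (hc _ hx _ hy (Linked.sumCongr_inr_iff.2 h))⟩⟩
  · rintro ⟨⟨ha, hb, hc⟩, ⟨ha', hb', hc'⟩⟩
    refine ⟨?_, ?_, ?_⟩
    · rintro (x | x)
      · simpa using ha x
      · simpa using ha' x
    · rintro (x | x)
      · simpa using hb x
      · simpa using hb' x
    · rw [h1]
      rintro (x | x) hx (y | y) hy h
      · rw [hc x hx y hy (Linked.sumCongr_inl_iff.1 h)]
      · exact (Linked.not_sumCongr_inl_inr h).elim
      · exact (Linked.not_sumCongr_inl_inr h.symm).elim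
      · rw [hc' x hx y hy (Linked.sumCongr_inr_iff.1 h)]

/-- The number of rooted pairs of permutations of `V` with set of roots `R`. -/
noncomputable def pairCount (V : Type*) (R : Set V) : ℕ :=
  Nat.card {p : Perm V × Perm V // IsRooted R p.1 p.2}

/-- The number of connected rooted pairs of permutations of `V` with set of roots `R`. -/
noncomputable def connCount (V : Type*) (R : Set V) : ℕ :=
  Nat.card {p : Perm V × Perm V // IsRooted R p.1 p.2 ∧ ∀ x y, Linked p.1 p.2 x y}

theorem pairCount_preimage {V W : Type*} (e : V ≃ W) (R : Set W) :
    pairCount V (e ⁻¹' R) = pairCount W R :=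
  Nat.card_congr (Equiv.subtypeEquiv (prodCongr e.permCongr e.permCongr)
    fun _ => (isRooted_permCongr_iff e).symm)

theorem connCount_preimage {V W : Type*} (e : V ≃ W) (R : Set W) :
    connCount V (e ⁻¹' R) = connCount W R := by
  refine Nat.card_congr (Equiv.subtypeEquiv (prodCongr e.permCongr e.permCongr) fun p =>
    and_congr (isRooted_permCongr_iff e).symm ⟨fun h x y => ?_, fun h x y => ?_⟩)
  · have := (Linked.permCongr_iff e).2 (h (e.symm x) (e.symm y))
    simpa using this
  · exact (Linked.permCongr_iff e).1 (h (e x) (e y))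

/-- `pairCount` for `n` half-edges and `N` roots. -/
noncomputable def pairNum (n N : ℕ) : ℕ := pairCount (Fin n ⊕ Fin N) (Set.range Sum.inr)

/-- `connCount` for `n` half-edges and `N` roots. -/
noncomputable def connNum (n N : ℕ) : ℕ := connCount (Fin n ⊕ Fin N) (Set.range Sum.inr)

theorem exists_equiv_fin_sum_fin {V : Type*} [Finite V] {R : Set V} {n N : ℕ}
    (hn : Rᶜ.ncard = n) (hN : R.ncard = N) :
    ∃ e : Fin n ⊕ Fin N ≃ V, e ⁻¹' R = Set.range Sum.inr := by
  classical
  let e1 : Fin n ≃ ↥Rᶜ := (Finite.equivFinOfCardEq hn).symm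
  let e2 : Fin N ≃ R := (Finite.equivFinOfCardEq hN).symm
  refine ⟨(sumCongr e1 e2).trans ((sumComm _ _).trans (Set.sumCompl R)), ?_⟩
  ext (x | x)
  · simpa [-Subtype.coe_prop] using Set.notMem_of_mem_compl (e1 x).2
  · simp

theorem pairCount_eq_pairNum {V : Type*} [Finite V] {R : Set V} {n N : ℕ}
    (hn : Rᶜ.ncard = n) (hN : R.ncard = N) : pairCount V R = pairNum n N := by
  obtain ⟨e, he⟩ := exists_equiv_fin_sum_fin hn hN
  rw [← pairCount_preimage e, he, pairNum]

theorem connCount_eq_connNum {V : Type*} [Finite V] {R : Set V} {n N : ℕ}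
    (hn : Rᶜ.ncard = n) (hN : R.ncard = N) : connCount V R = connNum n N := by
  obtain ⟨e, he⟩ := exists_equiv_fin_sum_fin hn hN
  rw [← connCount_preimage e, he, connNum]

theorem connNum_le_pairNum (n N : ℕ) : connNum n N ≤ pairNum n N :=
  Nat.card_le_card_of_injective (fun p => (⟨p.1, p.2.1⟩ :
    {p : Perm (Fin n ⊕ Fin N) × Perm (Fin n ⊕ Fin N) // IsRooted (Set.range Sum.inr) p.1 p.2}))
    fun _ _ h => Subtype.ext (by simpa using h)

/-- If the orbit of `a` is exactly `A`, both permutations preserve `A` and hence `B`, so the pair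
splits into a connected one on `A` and an arbitrary one on `B`. -/
theorem card_component_eq_range_inl {A B : Type*} [Finite A] [Finite B] (R : Set (A ⊕ B)) (a : A) :
    Nat.card {p : Perm (A ⊕ B) × Perm (A ⊕ B) // IsRooted R p.1 p.2 ∧
      {y | Linked p.1 p.2 (.inl a) y} = Set.range Sum.inl} =
    connCount A (Sum.inl ⁻¹' R) * pairCount B (Sum.inr ⁻¹' R) := by
  have hrange : ∀ q : {p : Perm A × Perm A // IsRooted (Sum.inl ⁻¹' R) p.1 p.2 ∧
      ∀ x y, Linked p.1 p.2 x y} × {p : Perm B × Perm B // IsRooted (Sum.inr ⁻¹' R) p.1 p.2},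
      {y | Linked (sumCongr q.1.1.1 q.2.1.1) (sumCongr q.1.1.2 q.2.1.2) (.inl a) y} =
        Set.range Sum.inl := by
    intro q
    ext (y | y)
    · simpa [Linked.sumCongr_inl_iff] using q.1.2.2 a y
    · simpa using Linked.not_sumCongr_inl_inr
  rw [connCount, pairCount, ← Nat.card_prod]
  refine (Nat.card_congr (Equiv.ofBijective (fun q => ⟨(sumCongr q.1.1.1 q.2.1.1,
    sumCongr q.1.1.2 q.2.1.2), isRooted_sumCongr_iff.2 ⟨q.1.2.1, q.2.2⟩, hrange q⟩) ⟨?_, ?_⟩)).symm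
  · rintro ⟨⟨⟨α, τ⟩, h⟩, ⟨⟨α', τ'⟩, h'⟩⟩ ⟨⟨⟨β, υ⟩, k⟩, ⟨⟨β', υ'⟩, k'⟩⟩ hq
    simp only [Subtype.mk.injEq, Prod.mk.injEq] at hq ⊢
    have h1 := Perm.sumCongrHom_injective (α := A) (β := B) (a₁ := (α, α')) (a₂ := (β, β')) hq.1
    have h2 := Perm.sumCongrHom_injective (α := A) (β := B) (a₁ := (τ, τ')) (a₂ := (υ, υ')) hq.2
    simp only [Prod.mk.injEq] at h1 h2
    exact ⟨⟨h1.1, h2.1⟩, ⟨h1.2, h2.2⟩⟩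
  · rintro ⟨⟨f, g⟩, hR, hK⟩
    simp only at hR hK
    have hf : Set.MapsTo f (Set.range Sum.inl) (Set.range Sum.inl) := by
      rw [← hK]
      exact fun z hz => Linked.trans hz (Linked.apply_left f g z)
    have hg : Set.MapsTo g (Set.range Sum.inl) (Set.range Sum.inl) := by
      rw [← hK]
      exact fun z hz => Linked.trans hz (Linked.apply_right f g z)
    obtain ⟨⟨α, α'⟩, rfl⟩ := Perm.mem_sumCongrHom_range_of_perm_mapsTo_inl hf
    obtain ⟨⟨τ, τ'⟩, rfl⟩ := Perm.mem_sumCongrHom_range_of_perm_mapsTo_inl hg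
    obtain ⟨h1, h2⟩ := isRooted_sumCongr_iff.1 hR
    have h3 : ∀ y, Linked α τ a y := fun y => by
      have h4 : Sum.inl y ∈ Set.range (Sum.inl : A → A ⊕ B) := ⟨y, rfl⟩
      rw [← hK] at h4
      exact Linked.sumCongr_inl_iff.1 h4
    exact ⟨⟨⟨(α, τ), h1, fun x y => (h3 x).symm.trans (h3 y)⟩, ⟨(α', τ'), h2⟩⟩, rfl⟩

theorem card_component_eq {V : Type*} [Finite V] (R : Set V) (S : Set V) {r : V} (hr : r ∈ S) :
    Nat.card {p : Perm V × Perm V // IsRooted R p.1 p.2 ∧ {y | Linked p.1 p.2 r y} = S} =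
      connCount S (Subtype.val ⁻¹' R) * pairCount ↥Sᶜ (Subtype.val ⁻¹' R) := by
  classical
  set e : ↥S ⊕ ↥Sᶜ ≃ V := Set.sumCompl S with he
  have h := card_component_eq_range_inl (e ⁻¹' R) (⟨r, hr⟩ : S)
  have h1 : Sum.inl ⁻¹' (e ⁻¹' R) = (Subtype.val ⁻¹' R : Set S) := by ext; simp [he]
  have h2 : Sum.inr ⁻¹' (e ⁻¹' R) = (Subtype.val ⁻¹' R : Set ↥Sᶜ) := by ext; simp [he]
  rw [h1, h2] at h
  rw [← h]
  refine (Nat.card_congr (Equiv.subtypeEquiv (prodCongr e.permCongr e.permCongr) fun p =>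
    and_congr (isRooted_permCongr_iff e).symm ?_)).symm
  have h3 : e (.inl ⟨r, hr⟩) = r := by simp [he]
  have h4 : e ⁻¹' {y | Linked (e.permCongr p.1) (e.permCongr p.2) r y} =
      {y | Linked p.1 p.2 (.inl ⟨r, hr⟩) y} := by
    ext y
    change Linked (e.permCongr p.1) (e.permCongr p.2) r (e y) ↔ _
    nth_rw 1 [← h3]
    exact Linked.permCongr_iff e
  have h5 : e ⁻¹' S = Set.range Sum.inl := by
    ext (x | x)
    · simp [he]
    · simpa [he] using Set.notMem_of_mem_compl x.2
  rw [← h4, ← h5]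
  exact e.surjective.preimage_injective.eq_iff

theorem card_component_eq_connNum_mul_pairNum {n N : ℕ} (P : Finset (Fin n)) (Q : Finset (Fin N)) :
    Nat.card {p : Perm (Fin n ⊕ Option (Fin N)) × Perm (Fin n ⊕ Option (Fin N)) //
      IsRooted (Set.range Sum.inr) p.1 p.2 ∧ {y | Linked p.1 p.2 (.inr none) y} =
        {x | Sum.elim (fun a => a ∈ P) (fun o => o ∈ Finset.insertNone Q) x}} =
    connNum P.card (Q.card + 1) * pairNum (n - P.card) (N - Q.card) := by
  classical
  set S : Set (Fin n ⊕ Option (Fin N)) :=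
    {x | Sum.elim (fun a => a ∈ P) (fun o => o ∈ Finset.insertNone Q) x} with hS
  have hr : Sum.inr none ∈ S := by simp [hS]
  have hcard : ∀ T R : Set (Fin n ⊕ Option (Fin N)), (Subtype.val ⁻¹' R : Set T).ncard =
      (T ∩ R).ncard := fun T R => by
    rw [← Subtype.image_preimage_coe, Set.ncard_image_of_injective _ Subtype.val_injective]
  have hl : ∀ X : Finset (Fin n), (Sum.inl '' (X : Set (Fin n)) :
      Set (Fin n ⊕ Option (Fin N))).ncard = X.card := fun X => by
    rw [Set.ncard_image_of_injective _ Sum.inl_injective, Set.ncard_coe_finset]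
  have hr' : ∀ X : Finset (Option (Fin N)), (Sum.inr '' (X : Set (Option (Fin N))) :
      Set (Fin n ⊕ Option (Fin N))).ncard = X.card := fun X => by
    rw [Set.ncard_image_of_injective _ Sum.inr_injective, Set.ncard_coe_finset]
  have e1 : S ∩ (Set.range Sum.inr)ᶜ = Sum.inl '' (P : Set (Fin n)) := by
    ext (x | x) <;> simp [hS]
  have e2 : S ∩ Set.range Sum.inr = Sum.inr '' (Finset.insertNone Q : Set (Option (Fin N))) := by
    ext (x | x) <;> simp [hS]
  have e3 : Sᶜ ∩ (Set.range Sum.inr)ᶜ = Sum.inl '' ((Pᶜ : Finset (Fin n)) : Set (Fin n)) := by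
    ext (x | x) <;> simp [hS]
  have e4 : Sᶜ ∩ Set.range Sum.inr =
      Sum.inr '' ((Qᶜ.map Function.Embedding.some : Finset _) : Set (Option (Fin N))) := by
    ext (x | (_ | x)) <;> simp [hS]
  rw [card_component_eq _ S hr]
  congr 1
  · refine connCount_eq_connNum ?_ ?_
    · rw [← Set.preimage_compl, hcard, e1, hl]
    · rw [hcard, e2, hr', Finset.card_insertNone]
  · refine pairCount_eq_pairNum ?_ ?_
    · rw [← Set.preimage_compl, hcard, e3, hl, Finset.card_compl, Fintype.card_fin]
    · rw [hcard, e4, hr', Finset.card_map, Finset.card_compl, Fintype.card_fin]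

/-- Splitting off the component of the first root. -/
theorem pairNum_succ (n N : ℕ) : pairNum n (N + 1) =
    ∑ m ∈ Finset.range (n + 1), ∑ k ∈ Finset.range (N + 1),
      n.choose m * N.choose k * (connNum m (k + 1) * pairNum (n - m) (N - k)) := by
  classical
  -- The root whose component is split off becomes `none`.
  have h0 : pairNum n (N + 1) =
      pairCount (Fin n ⊕ Option (Fin N)) (Set.range Sum.inr) := by
    refine (pairCount_eq_pairNum ?_ ?_).symm
    · rw [Set.compl_range_inr, ← Set.image_univ,
        Set.ncard_image_of_injective _ Sum.inl_injective, Set.ncard_univ, Nat.card_fin]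
    · rw [← Set.image_univ, Set.ncard_image_of_injective _ Sum.inr_injective, Set.ncard_univ]
      simp
  have h1 : pairNum n (N + 1) = ∑ P : Finset (Fin n), ∑ Q : Finset (Fin N),
      connNum P.card (Q.card + 1) * pairNum (n - P.card) (N - Q.card) := by
    rw [h0, pairCount, ← Fintype.sum_prod_type' (f := fun P Q =>
      connNum (Finset.card P) (Finset.card Q + 1) * pairNum (n - P.card) (N - Q.card))]
    let f : {p : Perm (Fin n ⊕ Option (Fin N)) × Perm (Fin n ⊕ Option (Fin N)) //
        IsRooted (Set.range Sum.inr) p.1 p.2} → Finset (Fin n) × Finset (Fin N) := fun p =>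
      (Finset.univ.filter fun a => Linked p.1.1 p.1.2 (.inr none) (.inl a),
        Finset.univ.filter fun i => Linked p.1.1 p.1.2 (.inr none) (.inr (some i)))
    rw [Nat.card_congr (Equiv.sigmaFiberEquiv f).symm, Nat.card_sigma]
    refine Finset.sum_congr rfl fun ⟨P, Q⟩ _ => ?_
    rw [← card_component_eq_connNum_mul_pairNum]
    refine Nat.card_congr ((Equiv.subtypeSubtypeEquivSubtypeInter _
      (fun p : Perm (Fin n ⊕ Option (Fin N)) × Perm (Fin n ⊕ Option (Fin N)) =>
        {y | Linked p.1 p.2 (.inr none) y} =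
        {x | Sum.elim (fun a => a ∈ P) (fun o => o ∈ Finset.insertNone Q) x})).symm.trans
      (Equiv.subtypeEquivRight fun p => ?_)).symm
    simp only [f, Prod.mk.injEq, Finset.ext_iff, Set.ext_iff, Sum.forall, Option.forall,
      Finset.mem_filter, Finset.mem_univ, true_and, Set.mem_ofPred_eq, Sum.elim_inl, Sum.elim_inr,
      Finset.some_mem_insertNone, Finset.none_mem_insertNone, Linked.refl]
  -- The summand depends only on the sizes of `P` and `Q`, whence the binomial coefficients.
  rw [h1, ← Finset.powerset_univ, ← Finset.powerset_univ]
  have h2 : ∀ m, ∑ Q ∈ (Finset.univ : Finset (Fin N)).powerset,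
      connNum m (Q.card + 1) * pairNum (n - m) (N - Q.card) =
      ∑ k ∈ Finset.range (N + 1), N.choose k * (connNum m (k + 1) * pairNum (n - m) (N - k)) :=
    fun m => by
      rw [Finset.sum_powerset_apply_card fun k => connNum m (k + 1) * pairNum (n - m) (N - k)]
      simp
  simp only [h2]
  rw [Finset.sum_powerset_apply_card fun m =>
    ∑ k ∈ Finset.range (N + 1), N.choose k * (connNum m (k + 1) * pairNum (n - m) (N - k))]
  simp [Finset.mul_sum, mul_assoc]

/-! ### Counting all rooted pairs. -/

/-- The number of permutations of `V` whose cycles contain at most one element of `R` each. -/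
noncomputable def separatingCount (V : Type*) (R : Set V) : ℕ :=
  Nat.card {τ : Perm V // ∀ x ∈ R, ∀ y ∈ R, Linked 1 τ x y → x = y}

theorem separatingCount_preimage {V W : Type*} (e : V ≃ W) (R : Set W) :
    separatingCount V (e ⁻¹' R) = separatingCount W R := by
  have h1 : e.permCongr (1 : Perm V) = 1 := by ext; simp [permCongr_apply]
  refine Nat.card_congr (Equiv.subtypeEquiv e.permCongr fun τ => ?_)
  have h2 : ∀ x y, Linked 1 (e.permCongr τ) (e x) (e y) ↔ Linked 1 τ x y := fun x y => by
    rw [← h1, Linked.permCongr_iff]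
  constructor
  · intro h x hx y hy hxy
    obtain ⟨x, rfl⟩ := e.surjective x
    obtain ⟨y, rfl⟩ := e.surjective y
    rw [h x hx y hy ((h2 x y).1 hxy)]
  · intro h x hx y hy hxy
    exact e.injective (h _ hx _ hy ((h2 x y).2 hxy))

/-- The permutation attached to `(a, τ)` is `τ` with `none` inserted just before `a`, or left as a
fixed point if `a = none`. Cycles among the old points are unaffected. -/
theorem linked_decomposeOption_symm {V : Type*} [DecidableEq V] (a : Option V) (τ : Perm V)
    (x y : V) : Linked 1 (Perm.decomposeOption.symm (a, τ)) (some x) (some y) ↔ Linked 1 τ x y := by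
  set υ := Perm.decomposeOption.symm (a, τ) with hυ
  have hnone : υ none = a := by simp [hυ]
  have hsome : ∀ z, υ (some z) = if some (τ z) = a then none else some (τ z) := by
    intro z
    simp [hυ, swap_apply_def]
  constructor
  · intro h
    -- The new point is collapsed onto its successor; if it is a fixed point, any value such as `x`
    -- will do.
    refine h.map (fun o => o.getD (a.getD x)) (fun z => Linked.refl _ _ _) ?_
    rintro (_ | z)
    · rw [hnone]
      cases a <;> exact Linked.refl _ _ _
    · rw [hsome]
      split_ifs with hz
      · rw [← hz]
        exact Linked.apply_right 1 τ z
      · exact Linked.apply_right 1 τ z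
  · refine Linked.map some (fun z => Linked.refl _ _ _) fun z => ?_
    have h := Linked.apply_right 1 υ (some z)
    rw [hsome] at h
    split_ifs at h with hz
    · refine h.trans ?_
      rw [hz, ← hnone]
      exact Linked.apply_right 1 υ none
    · exact h

/-- The new point is not a root, so each of its `Nat.card V + 1` positions is allowed. -/
theorem separatingCount_option {V : Type*} [Finite V] (R : Set V) :
    separatingCount (Option V) (some '' R) = (Nat.card V + 1) * separatingCount V R := by
  classical
  rw [separatingCount, separatingCount, ← Finite.card_option, ← Nat.card_prod]
  refine Nat.card_congr (Equiv.trans (Equiv.subtypeEquiv Perm.decomposeOption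
    (q := fun q : Option V × Perm V => ∀ x ∈ R, ∀ y ∈ R, Linked 1 q.2 x y → x = y) ?_)
    ⟨fun q => (q.1.1, ⟨q.1.2, q.2⟩), fun q => ⟨(q.1, q.2.1), q.2.2⟩, fun _ => rfl, fun _ => rfl⟩)
  intro υ
  obtain ⟨⟨a, τ⟩, rfl⟩ := Perm.decomposeOption.symm.surjective υ
  simp only [Equiv.apply_symm_apply, Set.forall_mem_image, linked_decomposeOption_symm,
    Option.some.injEq]

theorem separatingCount_mul_factorial (n N : ℕ) :
    separatingCount (Fin n ⊕ Fin N) (Set.range Sum.inr) * N ! = (n + N)! := by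
  induction n with
  | zero =>
    -- With only roots every cycle is a single point, so the permutation is the identity.
    have : separatingCount (Fin 0 ⊕ Fin N) (Set.range Sum.inr) = 1 := by
      rw [separatingCount, Nat.card_eq_one_iff_unique]
      refine ⟨⟨fun τ υ => ?_⟩, ⟨1, fun x _ y _ h => ?_⟩⟩
      · have h : ∀ τ : {τ : Perm (Fin 0 ⊕ Fin N) // ∀ x ∈ Set.range Sum.inr,
            ∀ y ∈ Set.range Sum.inr, Linked 1 τ x y → x = y}, τ.1 = 1 := by
          intro τ
          have hmem : ∀ z : Fin 0 ⊕ Fin N, z ∈ Set.range Sum.inr := by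
            rintro (z | z)
            · exact z.elim0
            · exact ⟨z, rfl⟩
          ext1 x
          exact (τ.2 x (hmem x) (τ.1 x) (hmem _) (Linked.apply_right 1 τ.1 x)).symm
        exact Subtype.ext ((h τ).trans (h υ).symm)
      · have := (h {x} (fun _ => Iff.rfl) (fun _ => Iff.rfl)).1 rfl
        exact this.symm
    rw [this, one_mul, zero_add]
  | succ n ih =>
    obtain ⟨e, he⟩ := exists_equiv_fin_sum_fin (V := Option (Fin n ⊕ Fin N))
      (R := some '' Set.range Sum.inr) (n := n + 1) (N := N) (by
        have h := Set.ncard_add_ncard_compl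
          (some '' Set.range (Sum.inr : Fin N → Fin n ⊕ Fin N))
        rw [Set.ncard_image_of_injective _ (Option.some_injective _), ← Set.image_univ,
          Set.ncard_image_of_injective _ Sum.inr_injective, Set.ncard_univ] at h
        simp only [Nat.card_eq_fintype_card, Fintype.card_fin, Fintype.card_option,
          Fintype.card_sum, Set.image_univ] at h
        omega) (by
        rw [Set.ncard_image_of_injective _ (Option.some_injective _), ← Set.image_univ,
          Set.ncard_image_of_injective _ Sum.inr_injective, Set.ncard_univ, Nat.card_fin])
    rw [← he, separatingCount_preimage, separatingCount_option, mul_assoc, ih,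
      Nat.card_eq_fintype_card, Fintype.card_sum, Fintype.card_fin, Fintype.card_fin,
      ← Nat.factorial_succ]
    congr 1
    omega

/-- For `n = 2k` these are the permutations of cycle type `2^k`, numbering `n! / (2^k k!) = n! /
n‼`. -/
theorem card_fixedPointFree_involution (n : ℕ) :
    Nat.card {α : Perm (Fin n) // (∀ x, α (α x) = x) ∧ ∀ x, α x ≠ x} =
      if Even n then (n - 1)‼ else 0 := by
  classical
  have hsq : ∀ α : Perm (Fin n), (∀ x, α (α x) = x) ↔ α ^ 2 = 1 := fun α => by
    rw [Perm.ext_iff]; simp [sq]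
  have hsupp : ∀ α : Perm (Fin n), (∀ x, α x ≠ x) ↔ α.support.card = n := fun α => by
    have : α.support.card = n ↔ α.support = Finset.univ := by
      rw [← Finset.card_eq_iff_eq_univ, Fintype.card_fin]
    rw [this, Finset.eq_univ_iff_forall]
    simp
  split_ifs with hn
  · obtain ⟨k, hk⟩ := hn
    have h1 : ∀ α : Perm (Fin n), ((∀ x, α (α x) = x) ∧ ∀ x, α x ≠ x) ↔
        α.cycleType = Multiset.replicate k 2 := by
      intro α
      rw [hsq, hsupp, ← Perm.sum_cycleType]
      constructor
      · rintro ⟨h2, h3⟩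
        have h4 := Perm.cycleType_of_pow_prime_eq_one h2
        rw [h4, Multiset.sum_replicate, smul_eq_mul] at h3
        rw [h4]
        congr 1
        omega
      · intro h
        rw [h, Perm.pow_prime_eq_one_iff, h]
        exact ⟨fun c hc => Multiset.eq_of_mem_replicate hc, by simp; omega⟩
    have h2 := Perm.card_of_cycleType_mul_eq (Fin n) (Multiset.replicate k 2)
    rw [if_pos ⟨by simp; omega, fun a ha => (Multiset.eq_of_mem_replicate ha).ge⟩] at h2
    have h3 : ∏ m ∈ (Multiset.replicate k 2).toFinset, ((Multiset.replicate k 2).count m)! = k ! := by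
      rcases Nat.eq_zero_or_pos k with rfl | hk
      · simp
      · rw [Multiset.toFinset_replicate, if_neg hk.ne', Finset.prod_singleton,
          Multiset.count_replicate_self]
    have h4 : Nat.card {α : Perm (Fin n) // (∀ x, α (α x) = x) ∧ ∀ x, α x ≠ x} =
        (Finset.univ.filter fun g : Perm (Fin n) => g.cycleType = Multiset.replicate k 2).card := by
      rw [Nat.card_eq_fintype_card, Fintype.card_subtype]
      simp only [h1]
    rw [h3, ← h4, Fintype.card_fin, Multiset.sum_replicate, Multiset.prod_replicate, smul_eq_mul,
      show n - k * 2 = 0 by omega, Nat.factorial_zero, one_mul, ← Nat.doubleFactorial_two_mul,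
      show 2 * k = n by omega] at h2
    refine Nat.eq_of_mul_eq_mul_right (Nat.doubleFactorial_pos n) (h2.trans ?_)
    rcases n with _ | n
    · rfl
    · rw [Nat.factorial_eq_mul_doubleFactorial, mul_comm, Nat.add_sub_cancel]
  · rw [Nat.card_eq_zero]
    refine Or.inl ⟨fun α => hn ?_⟩
    have h2 := (hsq α.1).1 α.2.1
    have h3 := (hsupp α.1).1 α.2.2
    rw [← Perm.sum_cycleType, Perm.cycleType_of_pow_prime_eq_one h2, Multiset.sum_replicate,
      smul_eq_mul] at h3
    rw [← h3]
    exact even_two.mul_left _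

theorem exists_eq_sumCongr_one {A B : Type*} [Finite A] [Finite B] {f : Perm (A ⊕ B)}
    (hf : ∀ b, f (.inr b) = .inr b) : ∃ g : Perm A, f = sumCongr g 1 := by
  have h : Set.MapsTo f (Set.range Sum.inl) (Set.range Sum.inl) := by
    rw [Perm.perm_mapsTo_inl_iff_mapsTo_inr]
    rintro _ ⟨b, rfl⟩
    exact ⟨b, (hf b).symm⟩
  obtain ⟨⟨g, g'⟩, rfl⟩ := Perm.mem_sumCongrHom_range_of_perm_mapsTo_inl h
  have hg' : g' = 1 := by
    ext1 b
    simpa using hf b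
  exact ⟨g, by rw [hg']; rfl⟩

/-- The conditions on `α` and `τ` are independent, and `α` is determined by its restriction to the
half-edges. -/
theorem pairNum_eq_mul (n N : ℕ) : pairNum n N =
    (if Even n then (n - 1)‼ else 0) * separatingCount (Fin n ⊕ Fin N) (Set.range Sum.inr) := by
  rw [← card_fixedPointFree_involution, separatingCount, pairNum, pairCount, ← Nat.card_prod]
  have hq : ∀ q : {α : Perm (Fin n) // (∀ x, α (α x) = x) ∧ ∀ x, α x ≠ x} ×
      {τ : Perm (Fin n ⊕ Fin N) // ∀ x ∈ Set.range Sum.inr, ∀ y ∈ Set.range Sum.inr,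
        Linked 1 τ x y → x = y},
      IsRooted (Set.range Sum.inr) (sumCongr q.1.1 (1 : Perm (Fin N))) q.2.1 := by
    intro q
    refine ⟨?_, ?_, q.2.2⟩
    · rintro (x | x)
      · simpa using q.1.2.1 x
      · simp
    · rintro (x | x)
      · simpa using q.1.2.2 x
      · simp
  refine (Nat.card_congr (Equiv.ofBijective
    (fun q => ⟨(sumCongr q.1.1 1, q.2.1), hq q⟩) ⟨?_, ?_⟩)).symm
  · rintro ⟨⟨α, _⟩, ⟨τ, _⟩⟩ ⟨⟨β, _⟩, ⟨υ, _⟩⟩ h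
    simp only [Subtype.mk.injEq, Prod.mk.injEq] at h ⊢
    have h1 := Perm.sumCongrHom_injective (α := Fin n) (β := Fin N)
      (a₁ := (α, 1)) (a₂ := (β, 1)) h.1
    exact ⟨congrArg Prod.fst h1, h.2⟩
  · rintro ⟨⟨f, τ⟩, h1, h2, h3⟩
    simp only at h1 h2 h3
    obtain ⟨α, rfl⟩ := exists_eq_sumCongr_one fun x => (h2 (.inr x)).2 ⟨x, rfl⟩
    exact ⟨(⟨α, fun x => by simpa using h1 (.inl x), fun x => by simpa using h2 (.inl x)⟩,
      ⟨τ, h3⟩), rfl⟩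

theorem pairNum_mul_factorial (n N : ℕ) :
    pairNum n N * N ! = if Even n then (n - 1)‼ * (n + N)! else 0 := by
  rw [pairNum_eq_mul, mul_assoc, separatingCount_mul_factorial]
  split_ifs <;> simp

/-! ### Inserting root points into the cycles of a permutation. -/

section RootSwap

variable {A B : Type*} {r : B → A}

open Classical in
/-- The involution of `A ⊕ B` that exchanges each `b : B` with its image under an injection
`r : B → A`. -/
noncomputable def rootSwap (hr : Function.Injective r) : Perm (A ⊕ B) :=
  Function.Involutive.toPerm
    (Sum.elim (fun a => if h : ∃ b, r b = a then .inr h.choose else .inl a) fun b => .inl (r b)) <| by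
    rintro (a | b)
    · by_cases h : ∃ b, r b = a
      · simp [h, h.choose_spec]
      · simp [h]
    · have h : ∃ b', r b' = r b := ⟨b, rfl⟩
      simp [hr h.choose_spec]

variable (hr : Function.Injective r)

@[simp]
theorem rootSwap_inr (b : B) : rootSwap hr (.inr b) = .inl (r b) := rfl

@[simp]
theorem rootSwap_rootSwap (x : A ⊕ B) : rootSwap hr (rootSwap hr x) = x :=
  (rootSwap hr).left_inv x

theorem rootSwap_inl_root (b : B) : rootSwap hr (.inl (r b)) = .inr b := by
  rw [← rootSwap_inr hr b, rootSwap_rootSwap]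

theorem rootSwap_inl_of_notMem {a : A} (h : ¬ ∃ b, r b = a) : rootSwap hr (.inl a) = .inl a :=
  dif_neg h

/-- Insert each `b : B` into a cycle of `σ`, just before the element `r b`. -/
noncomputable def insertRoots (σ : Perm A) : Perm (A ⊕ B) := rootSwap hr * sumCongr σ 1

@[simp]
theorem insertRoots_inr (σ : Perm A) (b : B) : insertRoots hr σ (.inr b) = .inl (r b) := rfl

theorem insertRoots_inl (σ : Perm A) (a : A) :
    insertRoots hr σ (.inl a) = rootSwap hr (.inl (σ a)) := rfl

theorem linked_insertRoots_inr (f : Perm (A ⊕ B)) (σ : Perm A) (b : B) :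
    Linked f (insertRoots hr σ) (.inr b) (.inl (r b)) :=
  Linked.apply_right f (insertRoots hr σ) (.inr b)

theorem linked_insertRoots_iff (α σ : Perm A) (x y : A) :
    Linked (sumCongr α (1 : Perm B)) (insertRoots hr σ) (.inl x) (.inl y) ↔ Linked α σ x y := by
  constructor
  -- Each inserted point is collapsed onto its successor `r b`.
  · refine Linked.map (Sum.elim id r) ?_ ?_
    · rintro (a | b)
      · exact Linked.apply_left α σ a
      · exact Linked.refl _ _ _
    · rintro (a | b)
      · rw [insertRoots_inl]
        by_cases h : ∃ b, r b = σ a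
        · obtain ⟨b, hb⟩ := h
          rw [← hb, rootSwap_inl_root]
          change Linked α σ a (r b)
          rw [hb]
          exact Linked.apply_right α σ a
        · rw [rootSwap_inl_of_notMem hr h]
          exact Linked.apply_right α σ a
      · exact Linked.refl _ _ _
  · refine Linked.map Sum.inl
      (fun a => Linked.apply_left (sumCongr α (1 : Perm B)) _ (.inl a)) fun a => ?_
    have h1 := Linked.apply_right (sumCongr α (1 : Perm B)) (insertRoots hr σ) (.inl a)
    rw [insertRoots_inl] at h1
    by_cases h : ∃ b, r b = σ a
    · obtain ⟨b, hb⟩ := h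
      rw [← hb, rootSwap_inl_root] at h1
      rw [← hb]
      exact h1.trans (linked_insertRoots_inr hr _ σ b)
    · rwa [rootSwap_inl_of_notMem hr h] at h1

theorem linked_one_insertRoots_iff (σ : Perm A) (b b' : B) :
    Linked 1 (insertRoots hr σ) (.inr b) (.inr b') ↔ σ.SameCycle (r b) (r b') := by
  have h1 : (1 : Perm (A ⊕ B)) = sumCongr (1 : Perm A) (1 : Perm B) := by ext (x | x) <;> rfl
  rw [← Linked.one_iff_sameCycle, ← linked_insertRoots_iff hr, ← h1]
  exact ⟨fun h => (linked_insertRoots_inr hr 1 σ b).symm.trans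
    (h.trans (linked_insertRoots_inr hr 1 σ b')), fun h => (linked_insertRoots_inr hr 1 σ b).trans
    (h.trans (linked_insertRoots_inr hr 1 σ b').symm)⟩

/-- Composing `τ` with the involution `rootSwap hr` fixes every point of `B`, which leaves a
permutation of `A`. -/
theorem exists_eq_insertRoots [Finite A] [Finite B] {τ : Perm (A ⊕ B)}
    (hτ : ∀ b, τ (.inr b) = .inl (r b)) : ∃ σ, τ = insertRoots hr σ := by
  obtain ⟨σ, hσ⟩ := exists_eq_sumCongr_one (f := rootSwap hr * τ) fun b => by
    rw [Perm.mul_apply, hτ, rootSwap_inl_root]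
  refine ⟨σ, ?_⟩
  rw [insertRoots, ← hσ]
  ext1 x
  simp

end RootSwap

/-- A root followed by a root must be followed by itself. Being fixed by `α` as well, it would be a
component of its own, which connectedness excludes when a half-edge exists. -/
theorem IsRooted.exists_apply_eq_inl {A B : Type*} [Nonempty A] {α τ : Perm (A ⊕ B)}
    (h : IsRooted (Set.range Sum.inr) α τ) (hc : ∀ x y, Linked α τ x y) (b : B) :
    ∃ a, τ (.inr b) = .inl a := by
  rcases hb : τ (.inr b) with a | b'
  · exact ⟨a, rfl⟩
  · exfalso
    have h1 := h.eq_of_linked _ ⟨b, rfl⟩ _ ⟨b', rfl⟩ (by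
      rw [← hb]; exact Linked.apply_right 1 τ _)
    have hτ : τ (.inr b) = .inr b := by rw [hb, ← h1]
    have hα : α (.inr b) = .inr b := (h.fixed_iff _).2 ⟨b, rfl⟩
    obtain ⟨a⟩ := ‹Nonempty A›
    have h2 := (hc (.inr b) (.inl a) {.inr b} (fun z => ?_) (fun z => ?_)).1 rfl
    · simp at h2
    · rw [Set.mem_singleton_iff, Set.mem_singleton_iff, ← α.apply_eq_iff_eq (x := z), hα]
    · rw [Set.mem_singleton_iff, Set.mem_singleton_iff, ← τ.apply_eq_iff_eq (x := z), hτ]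

/-! ### Rooted graphs as connected pairs, and their isomorphism classes. -/

namespace NRootedGraph

variable {N e : ℕ}

@[ext]
theorem ext' {Γ Γ' : NRootedGraph N e} (hα : Γ.α = Γ'.α) (hσ : Γ.σ = Γ'.σ)
    (hr : Γ.root = Γ'.root) : Γ = Γ' := by
  obtain ⟨⟨_, _, _, _, _⟩, _, _⟩ := Γ
  obtain ⟨⟨_, _, _, _, _⟩, _, _⟩ := Γ'
  simp only at hα hσ hr
  subst hα hσ hr
  rfl

theorem root_injective (Γ : NRootedGraph N e) : Function.Injective Γ.root := fun i j h => by
  by_contra hij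
  exact Γ.root_distinct i j hij (h ▸ Perm.SameCycle.refl _ _)

theorem linked (Γ : NRootedGraph N e) (x y : Fin (2 * e)) : Linked Γ.α Γ.σ x y :=
  Linked.forall_iff_isPretransitive.2 Γ.transitive x y

theorem isRooted_insertRoots (Γ : NRootedGraph N e) :
    IsRooted (Set.range Sum.inr) (sumCongr Γ.α (1 : Perm (Fin N)))
      (insertRoots Γ.root_injective Γ.σ) := by
  refine ⟨?_, ?_, ?_⟩
  · rintro (x | x)
    · simpa using Γ.involutive x
    · simp
  · rintro (x | x)
    · simpa using Γ.fixedPointFree x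
    · simp
  · rintro _ ⟨i, rfl⟩ _ ⟨j, rfl⟩ h
    by_contra hij
    exact Γ.root_distinct i j (fun h => hij (h ▸ rfl)) ((linked_one_insertRoots_iff _ _ _ _).1 h)

theorem linked_insertRoots (Γ : NRootedGraph N e) (x y : Fin (2 * e) ⊕ Fin N) :
    Linked (sumCongr Γ.α (1 : Perm (Fin N))) (insertRoots Γ.root_injective Γ.σ) x y := by
  have h : ∀ x : Fin (2 * e) ⊕ Fin N, ∃ a, Linked (sumCongr Γ.α (1 : Perm (Fin N)))
      (insertRoots Γ.root_injective Γ.σ) x (.inl a) := by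
    rintro (a | b)
    · exact ⟨a, Linked.refl _ _ _⟩
    · exact ⟨_, linked_insertRoots_inr _ _ _ b⟩
  obtain ⟨a, ha⟩ := h x
  obtain ⟨b, hb⟩ := h y
  exact ha.trans (((linked_insertRoots_iff _ _ _ _ _).2 (Γ.linked a b)).trans hb.symm)

/-- Root insertion is a bijection. The case `e = 0` differs: an isolated root point is a connected
pair, but there is no half-edge to choose as root. -/
theorem card_eq_connNum (he : e ≠ 0) : Nat.card (NRootedGraph N e) = connNum (2 * e) N := by
  refine Nat.card_congr (Equiv.ofBijective (fun Γ => ⟨(sumCongr Γ.α 1,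
    insertRoots Γ.root_injective Γ.σ), Γ.isRooted_insertRoots, Γ.linked_insertRoots⟩) ⟨?_, ?_⟩)
  · intro Γ Γ' h
    simp only [Subtype.mk.injEq, Prod.mk.injEq] at h
    have hα := Perm.sumCongrHom_injective (α := Fin (2 * e)) (β := Fin N)
      (a₁ := (Γ.α, 1)) (a₂ := (Γ'.α, 1)) h.1
    have hr : Γ.root = Γ'.root := by
      funext b
      have := congrArg (fun τ => τ (Sum.inr b)) h.2
      simpa using this
    refine ext' (congrArg Prod.fst hα) ?_ hr
    have hσ := h.2
    simp only [insertRoots, hr] at hσ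
    have := Perm.sumCongrHom_injective (α := Fin (2 * e)) (β := Fin N)
      (a₁ := (Γ.σ, 1)) (a₂ := (Γ'.σ, 1)) (mul_left_cancel hσ)
    exact congrArg Prod.fst this
  · rintro ⟨⟨f, τ⟩, h, hc⟩
    simp only at h hc
    have : Nonempty (Fin (2 * e)) := ⟨⟨0, by omega⟩⟩
    obtain ⟨α, rfl⟩ := exists_eq_sumCongr_one fun x => (h.fixed_iff (.inr x)).2 ⟨x, rfl⟩
    choose r hr using fun b => h.exists_apply_eq_inl hc b
    have hinj : Function.Injective r := fun i j hij =>
      Sum.inr_injective (τ.injective (by rw [hr, hr, hij]))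
    obtain ⟨σ, rfl⟩ := exists_eq_insertRoots hinj hr
    refine ⟨⟨⟨α, σ, fun x => by simpa using h.involutive (.inl x),
      fun x => by simpa using h.fixed_iff (.inl x), Linked.forall_iff_isPretransitive.1 fun x y =>
        (linked_insertRoots_iff hinj α σ x y).1 (hc _ _)⟩, r, fun i j hij hs => hij ?_⟩, rfl⟩
    exact Sum.inr_injective (h.eq_of_linked _ ⟨i, rfl⟩ _ ⟨j, rfl⟩
      ((linked_one_insertRoots_iff hinj σ i j).2 hs))

/-- Relabelling of the half-edges. -/
def relabel (ψ : Perm (Fin (2 * e))) (Γ : NRootedGraph N e) : NRootedGraph N e where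
  α := ψ.permCongr Γ.α
  σ := ψ.permCongr Γ.σ
  involutive x := by simpa using congrArg ψ (Γ.involutive (ψ.symm x))
  fixedPointFree x h := Γ.fixedPointFree (ψ.symm x) (ψ.injective (by simpa using h))
  transitive := Linked.forall_iff_isPretransitive.1 fun x y => by
    simpa using (Linked.permCongr_iff ψ).2 (Γ.linked (ψ.symm x) (ψ.symm y))
  root i := ψ (Γ.root i)
  root_distinct i j hij h := Γ.root_distinct i j hij (by
    have h1 : ψ.permCongr (1 : Perm (Fin (2 * e))) = 1 := by ext; simp
    rwa [← Linked.one_iff_sameCycle, ← Linked.permCongr_iff ψ, h1, Linked.one_iff_sameCycle])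

theorem iso_iff_exists_relabel_eq {Γ Γ' : NRootedGraph N e} :
    Iso Γ Γ' ↔ ∃ ψ, relabel ψ Γ = Γ' := by
  constructor
  · rintro ⟨ψ, hα, hσ, hr⟩
    refine ⟨ψ, ext' ?_ ?_ (funext hr)⟩
    · rw [← eq_mul_inv_iff_mul_eq] at hα
      rw [hα]; rfl
    · rw [← eq_mul_inv_iff_mul_eq] at hσ
      rw [hσ]; rfl
  · rintro ⟨ψ, rfl⟩
    refine ⟨ψ, ?_, ?_, fun i => rfl⟩
    · ext x; simp [relabel]
    · ext x; simp [relabel]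

/-- The set where two relabellings with the same result agree is invariant under `α` and `σ` and
contains a root, so by transitivity it is everything. -/
theorem relabel_injective (hN : N ≠ 0) (Γ : NRootedGraph N e) :
    Function.Injective fun ψ => relabel ψ Γ := by
  intro ψ χ h
  have hα : ∀ x, ψ (Γ.α x) = (relabel ψ Γ).α (ψ x) := fun x => by simp [relabel]
  have hσ : ∀ x, ψ (Γ.σ x) = (relabel ψ Γ).σ (ψ x) := fun x => by simp [relabel]
  have hα' : ∀ x, χ (Γ.α x) = (relabel ψ Γ).α (χ x) := fun x => by
    rw [show relabel ψ Γ = relabel χ Γ from h]; simp [relabel]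
  have hσ' : ∀ x, χ (Γ.σ x) = (relabel ψ Γ).σ (χ x) := fun x => by
    rw [show relabel ψ Γ = relabel χ Γ from h]; simp [relabel]
  ext1 x
  refine (Γ.linked (Γ.root ⟨0, by omega⟩) x {x | ψ x = χ x} (fun z => ?_) (fun z => ?_)).1 ?_
  · change ψ _ = χ _ ↔ _
    rw [hα, hα']
    exact (Equiv.injective _).eq_iff
  · change ψ _ = χ _ ↔ _
    rw [hσ, hσ']
    exact (Equiv.injective _).eq_iff
  · exact congrFun (congrArg NRootedGraph.root h) _

/-- Relabelling is a free action whose orbits are the isomorphism classes. -/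
theorem card_eq_factorial_mul (hN : N ≠ 0) : Nat.card (NRootedGraph N e) =
    (2 * e)! * Nat.card (Quotient (NRootedGraph.setoid N e)) := by
  have h1 : (2 * e)! = Nat.card (Perm (Fin (2 * e))) := by
    rw [Nat.card_perm, Nat.card_fin]
  have h2 : ∀ ψ (Γ : NRootedGraph N e), (⟦relabel ψ Γ⟧ : Quotient (setoid N e)) = ⟦Γ⟧ := fun ψ Γ =>
    Quotient.sound (iso_iff_exists_relabel_eq.2 ⟨ψ, rfl⟩).symm
  rw [h1, ← Nat.card_prod]
  refine (Nat.card_congr (Equiv.ofBijective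
    (fun p : Perm (Fin (2 * e)) × Quotient (setoid N e) => relabel p.1 p.2.out) ⟨?_, ?_⟩)).symm
  · rintro ⟨ψ, q⟩ ⟨χ, q'⟩ h
    have hq := congrArg (fun Γ => (⟦Γ⟧ : Quotient (setoid N e))) h
    simp only [h2, Quotient.out_eq] at hq
    subst hq
    exact congrArg (·, q) (relabel_injective hN _ h)
  · intro Γ
    obtain ⟨ψ, hψ⟩ := iso_iff_exists_relabel_eq.1
      (Quotient.exact (Quotient.out_eq (⟦Γ⟧ : Quotient (setoid N e))))
    exact ⟨(ψ, ⟦Γ⟧), hψ⟩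

end NRootedGraph

/-! ### From the counts to the generating functions. -/

theorem connNum_zero {N : ℕ} (hN : N ≠ 0) : connNum 0 N = if N = 1 then 1 else 0 := by
  have hmem : ∀ z : Fin 0 ⊕ Fin N, z ∈ Set.range Sum.inr := by
    rintro (z | z)
    · exact z.elim0
    · exact ⟨z, rfl⟩
  split_ifs with h1
  · subst h1
    have : Subsingleton (Fin 0 ⊕ Fin 1) := ⟨fun x y => by
      obtain ⟨i, rfl⟩ := hmem x
      obtain ⟨j, rfl⟩ := hmem y
      rw [Subsingleton.elim i j]⟩
    rw [connNum, connCount, Nat.card_eq_one_iff_unique]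
    refine ⟨⟨fun p q => Subtype.ext (Subsingleton.elim _ _)⟩,
      ⟨(1, 1), ⟨fun x => rfl, fun x => by simp [hmem], fun x _ y _ _ => Subsingleton.elim _ _⟩,
        fun x y => ?_⟩⟩
    rw [Subsingleton.elim x y]
    exact Linked.refl _ _ _
  · rw [connNum, connCount, Nat.card_eq_zero]
    refine Or.inl ⟨?_⟩
    rintro ⟨⟨α, τ⟩, h, hc⟩
    simp only at h hc
    have hα : α = 1 := by
      ext1 x
      exact (h.fixed_iff x).2 (hmem x)
    subst hα
    have := h.eq_of_linked _ ⟨⟨0, by omega⟩, rfl⟩ _ ⟨⟨1, by omega⟩, rfl⟩ (hc _ _)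
    simp at this

theorem connNum_two_mul {N : ℕ} (hN : N ≠ 0) (e : ℕ) :
    connNum (2 * e) N = (2 * e)! * numNRootedMaps N e := by
  rw [numNRootedMaps]
  split_ifs with he h1
  · subst he; rw [mul_zero, connNum_zero hN, if_pos h1, Nat.factorial_zero]
  · subst he; rw [mul_zero, connNum_zero hN, if_neg h1, mul_zero]
  · rw [← NRootedGraph.card_eq_connNum he, NRootedGraph.card_eq_factorial_mul hN]

theorem connNum_of_odd {n : ℕ} (hn : ¬ Even n) (N : ℕ) : connNum n N = 0 := by
  have h := pairNum_mul_factorial n N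
  rw [if_neg hn, mul_eq_zero, or_iff_left (Nat.factorial_ne_zero N)] at h
  have := connNum_le_pairNum n N
  omega

theorem coeff_genNRootedMaps {N : ℕ} (hN : N ≠ 0) (n : ℕ) :
    PowerSeries.coeff n (genNRootedMaps N) = (connNum n N : ℚ) / (n ! : ℚ) := by
  rw [genNRootedMaps, PowerSeries.coeff_mk]
  split_ifs with hn
  · obtain ⟨e, rfl⟩ := hn.exists_two_nsmul
    rw [smul_eq_mul, Nat.mul_div_cancel_left _ two_pos, connNum_two_mul hN, Nat.cast_mul,
      mul_div_cancel_left₀ _ (by positivity)]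
  · rw [connNum_of_odd hn, Nat.cast_zero, zero_div]

theorem coeff_inv_factorial_smul_genZ (N n : ℕ) :
    PowerSeries.coeff n ((N ! : ℚ)⁻¹ • genZ N) = (pairNum n N : ℚ) / (n ! : ℚ) := by
  have h := congrArg (Nat.cast (R := ℚ)) (pairNum_mul_factorial n N)
  push_cast at h
  rw [PowerSeries.coeff_smul, smul_eq_mul, genZ, PowerSeries.coeff_mk]
  split_ifs at h ⊢ with hn
  · field_simp
    linear_combination -h
  · have h0 : (pairNum n N : ℚ) = 0 := by
      rcases mul_eq_zero.1 h with h | h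
      · exact h
      · exact absurd h (by positivity)
    simp [h0]

/-- This is `pairNum_succ` for exponential generating functions: the binomial convolution over
half-edges becomes a product. -/
theorem genZ_succ (N : ℕ) : ((N + 1)! : ℚ)⁻¹ • genZ (N + 1) =
    ∑ p ∈ Finset.HasAntidiagonal.antidiagonal N,
      (N.choose p.1 : ℚ) • (genNRootedMaps (p.1 + 1) * ((p.2 ! : ℚ)⁻¹ • genZ p.2)) := by
  ext n
  rw [coeff_inv_factorial_smul_genZ, map_sum, pairNum_succ, Finset.sum_comm,
    Finset.Nat.sum_antidiagonal_eq_sum_range_succ_mk, Nat.cast_sum, Finset.sum_div]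
  refine Finset.sum_congr rfl fun k _ => ?_
  rw [PowerSeries.coeff_smul, PowerSeries.coeff_mul,
    Finset.Nat.sum_antidiagonal_eq_sum_range_succ_mk, Nat.cast_sum, Finset.sum_div,
    Finset.smul_sum]
  refine Finset.sum_congr rfl fun m hm => ?_
  rw [coeff_genNRootedMaps (Nat.succ_ne_zero k), coeff_inv_factorial_smul_genZ]
  push_cast
  rw [Nat.cast_choose ℚ (Finset.mem_range_succ_iff.1 hm), smul_eq_mul]
  have h1 : (n ! : ℚ) ≠ 0 := by positivity
  have h2 : (m ! : ℚ) ≠ 0 := by positivity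
  have h3 : ((n - m)! : ℚ) ≠ 0 := by positivity
  field_simp

theorem constantCoeff_genZ_zero : PowerSeries.constantCoeff (genZ 0) = 1 := by
  rw [← PowerSeries.coeff_zero_eq_constantCoeff_apply, genZ, PowerSeries.coeff_mk]
  simp

theorem genNRootedMaps_eq_closedForm {N : ℕ} (hN : 1 ≤ N) :
    genNRootedMaps N = closedForm N := by
  have hZ : PowerSeries.constantCoeff (genZ 0) ≠ 0 := by simp [constantCoeff_genZ_zero]
  -- The coefficients of `t^j` in `F / 𝒵₀` and of `t^k` in its logarithm; the value at `k = 0` plays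
  -- no role.
  have h := PowerSeries.log_coeff_eq_sum_partitionTuples (R := ℚ⟦X⟧)
    (fun j => ((j ! : ℚ) ^ 2)⁻¹ • genZ j * (genZ 0)⁻¹)
    (fun k => (k ! : ℚ)⁻¹ • genNRootedMaps k) (by simp [PowerSeries.mul_inv_cancel _ hZ])
    (fun n => ?_) hN
  · have hN0 : (N ! : ℚ) ≠ 0 := by positivity
    rw [inv_smul_eq_iff₀ hN0] at h
    rw [h, closedForm, Finset.smul_sum]
    refine Finset.sum_congr rfl fun a _ => ?_
    have hinv : (genZ 0 ^ ∑ j, a j)⁻¹ = (genZ 0)⁻¹ ^ ∑ j, a j := by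
      symm
      rw [PowerSeries.eq_inv_iff_mul_eq_one (by rw [map_pow]; exact pow_ne_zero _ hZ), ← mul_pow,
        PowerSeries.inv_mul_cancel _ hZ, one_pow]
    rw [hinv, smul_smul]
    congr 1
    · ring
    · simp only [mul_pow, Finset.prod_mul_distrib, Finset.prod_pow_eq_pow_sum]
      ring
  · have hn : ∀ m : ℕ, ((m : ℚ⟦X⟧) + 1) = algebraMap ℚ ℚ⟦X⟧ ((m : ℚ) + 1) := fun m => by
      rw [map_add, map_natCast, map_one]
    have hL : ((n : ℚ⟦X⟧) + 1) * ((((n + 1)! : ℚ) ^ 2)⁻¹ • genZ (n + 1) * (genZ 0)⁻¹) =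
        (n ! : ℚ)⁻¹ • ((((n + 1)! : ℚ)⁻¹ • genZ (n + 1)) * (genZ 0)⁻¹) := by
      rw [hn, ← Algebra.smul_def, smul_mul_assoc, smul_mul_assoc, smul_smul, smul_smul]
      congr 1
      rw [Nat.factorial_succ]
      push_cast
      have h1 : (n ! : ℚ) ≠ 0 := by positivity
      have h2 : (n + 1 : ℚ) ≠ 0 := by positivity
      field_simp
    rw [hL, genZ_succ, Finset.sum_mul, Finset.smul_sum]
    refine Finset.sum_congr rfl fun p hp => ?_
    obtain ⟨i, j⟩ := p
    rw [Finset.HasAntidiagonal.mem_antidiagonal] at hp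
    subst hp
    rw [hn, ← Algebra.smul_def]
    simp only [smul_mul_assoc, mul_smul_comm, smul_smul, mul_assoc]
    congr 1
    rw [Nat.cast_add_choose, Nat.factorial_succ]
    push_cast
    have h1 : (i ! : ℚ) ≠ 0 := by positivity
    have h2 : (i + 1 : ℚ) ≠ 0 := by positivity
    have h3 : (j ! : ℚ) ≠ 0 := by positivity
    have h4 : ((i + j)! : ℚ) ≠ 0 := by positivity
    field_simp

theorem theorem2 (N : ℕ) (hN : 1 ≤ N) :
    genNRootedMaps N = closedForm N ∧
    (∀ e : ℕ, (numNRootedMaps N e : ℚ) = PowerSeries.coeff (2 * e) (closedForm N)) ∧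
    (∀ e : ℕ, (numNRootedMaps N e : ℚ) =
      1 / ((2 * e)! : ℚ) *
        PowerSeries.constantCoeff ((⇑(PowerSeries.derivative ℚ))^[2 * e] (genNRootedMaps N))) := by
  have hcoeff : ∀ e : ℕ, (numNRootedMaps N e : ℚ) =
      PowerSeries.coeff (2 * e) (genNRootedMaps N) := fun e => by
    rw [genNRootedMaps, PowerSeries.coeff_mk, if_pos (even_two_mul e),
      Nat.mul_div_cancel_left _ two_pos]
  refine ⟨genNRootedMaps_eq_closedForm hN, fun e => ?_, fun e => ?_⟩
  · rw [← genNRootedMaps_eq_closedForm hN, hcoeff]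
  · rw [PowerSeries.constantCoeff_iterate_derivative, hcoeff, one_div,
      inv_mul_cancel_left₀ (by positivity)]
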